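/- **Existence Theorem for Strong Provability Predicates.** Work in the first-order language of arithmetic $\{0, S, +, \times\}$ with equality. A *theory* is a set of sentences closed under logical consequence, and $T \vdash A$ means $A \in T$. *Peano Arithmetic* $\mathsf{PA}$ is the theory axiomatized by the axioms of Robinson Arithmetic together with induction for all formulas (parameters allowed), and an *extension* of $\mathsf{PA}$ is a theory $T \supseteq \mathsf{PA}$ in this language. For a sentence $A$ let $\ulcorner A \urcorner$ be the numeral $S\cdots S0$ of its Gödel number (with respect to a standard computable Gödel numbering). A theory $T$ is *computably enumerable* if it has a computable proof verifier, i.e. a computable $\mathrm{pc} \colon \mathbb{N}^2 \to \{0, 1\}$ such that for every sentence $A$: if $T \vdash A$, then $\mathrm{pc}(p, A) = 1$ for some $p \in \mathbb{N}$; and otherwise $\mathrm{pc}(p, A) = 0$ for all $p \in \mathbb{N}$ (here the second argument is the Gödel number of $A$). Let $T$ be a computably enumerable extension of $\mathsf{PA}$. Then $T$ has a strong provability predicate; that is, there is a formula $\mathrm{Pvb}(x)$ of the language of arithmetic with one free variable such that for all sentences $A, B$: 1. (Correctness) $\mathrm{Pvb}(\ulcorner A \urcorner)$ is true in the standard model $\mathbb{N}$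 if and only if $T \vdash A$. 2. (Representability) If $T \vdash A$, then $T \vdash \mathrm{Pvb}(\ulcorner A \urcorner)$. 3. (Distributivity) $T \vdash \mathrm{Pvb}(\ulcorner A \rightarrow B \urcorner) \rightarrow (\mathrm{Pvb}(\ulcorner A \urcorner) \rightarrow \mathrm{Pvb}(\ulcorner B \urcorner))$. 4. (Re-Representability) $T \vdash \mathrm{Pvb}(\ulcorner A \urcorner) \rightarrow \mathrm{Pvb}(\ulcorner \mathrm{Pvb}(\ulcorner A \urcorner) \urcorner)$. The theory $T$ is not assumed to be consistent or sound. -/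

import Mathlib

namespace Arith

open FirstOrder FirstOrder.Language

/-! ### The language of arithmetic -/

/-- The function symbols `0`, `S`, `+`, `×`. -/
inductive Func : ℕ → Type
  | zero : Func 0
  | succ : Func 1
  | add : Func 2
  | mul : Func 2

/-- The first-order language (with equality) of arithmetic. There are no relation symbols besides
equality. -/
def LA : FirstOrder.Language.{0, 0} := ⟨Func, fun _ => Empty⟩

variable {α : Type}

/-- The term `0`. -/
def tZero : LA.Term α := Term.func (L := LA) Func.zero ![]

/-- The term `S t`. -/
def tSucc (t : LA.Term α) : LA.Term α := Term.func (L := LA) Func.succ ![t]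

/-- The term `t + u`. -/
def tAdd (t u : LA.Term α) : LA.Term α := Term.func (L := LA) Func.add ![t, u]

/-- The term `t × u`. -/
def tMul (t u : LA.Term α) : LA.Term α := Term.func (L := LA) Func.mul ![t, u]

/-- The numeral `S ⋯ S 0` with `n` occurrences of `S`. -/
def numeral : ℕ → LA.Term α
  | 0 => tZero
  | n + 1 => tSucc (numeral n)

/-- The usual zero, successor, addition and multiplication of natural numbers. -/
def stdFun : {n : ℕ} → Func n → (Fin n → ℕ) → ℕ
  | _, Func.zero, _ => 0
  | _, Func.succ, v => v 0 + 1
  | _, Func.add, v => v 0 + v 1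
  | _, Func.mul, v => v 0 * v 1

/-- The intended interpretation of the language of arithmetic, with domain `ℕ`. -/
instance stdModel : LA.Structure ℕ where
  funMap := fun {_} (f : Func _) v => stdFun f v
  RelMap := fun {_} (r : Empty) => r.elim

/-- Truth of a sentence in the intended interpretation. -/
def IsTrue (A : LA.Sentence) : Prop := ℕ ⊨ A

/-! ### Theories, Robinson arithmetic and Peano arithmetic -/

/-- A theory is a set of sentences that is closed under logical consequence. For a theory `T`,
"`T` proves `A`" means `A ∈ T`. -/
def IsTheory (T : Set LA.Sentence) : Prop := ∀ A : LA.Sentence, T ⊨ᵇ A → A ∈ T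

/-- The axioms of Robinson arithmetic; in each of them the variables `x`, `y` are `&0`, `&1`. -/
inductive QAxiom : LA.Sentence → Prop
  /-- `∀ x, ¬ S x = 0` -/
  | s0 : QAxiom (∀' ∼(tSucc (&0) =' tZero))
  /-- `∀ x y, S x = S y → x = y` -/
  | s1 : QAxiom (∀' ∀' ((tSucc (&0) =' tSucc (&1)) ⟹ (&0 =' &1)))
  /-- `∀ x, x = 0 ∨ ∃ y, S y = x` -/
  | s2 : QAxiom (∀' ((&0 =' tZero) ⊔ ∃' (tSucc (&1) =' &0)))
  /-- `∀ x, x + 0 = x` -/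
  | a0 : QAxiom (∀' (tAdd (&0) tZero =' &0))
  /-- `∀ x y, x + S y = S (x + y)` -/
  | a1 : QAxiom (∀' ∀' (tAdd (&0) (tSucc (&1)) =' tSucc (tAdd (&0) (&1))))
  /-- `∀ x, x × 0 = 0` -/
  | m0 : QAxiom (∀' (tMul (&0) tZero =' tZero))
  /-- `∀ x y, x × S y = x + (x × y)` -/
  | m1 : QAxiom (∀' ∀' (tMul (&0) (tSucc (&1)) =' tAdd (&0) (tMul (&0) (&1))))

/-- The formula `P(t)`, where the variables of `P` are the parameters `Sum.inl i` and the induction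
variable `Sum.inr 0`, and `t` is put for the induction variable. -/
def substVar {n : ℕ} (P : LA.Formula (Fin n ⊕ Fin 1)) {β : Type} (e : Fin n → β)
    (t : LA.Term β) : LA.Formula β :=
  BoundedFormula.subst P (Sum.elim (fun i => Term.var (e i)) (fun _ => t))

/-- The universal closure (over the parameters) of the induction axiom
`(P(0) ∧ ∀ x, P(x) → P(S x)) → ∀ x, P(x)`. -/
noncomputable def inductionAxiom {n : ℕ} (P : LA.Formula (Fin n ⊕ Fin 1)) : LA.Sentence :=
  Formula.iAlls (Fin n) (Formula.relabel Sum.inr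
    ((substVar P id tZero ⊓
        Formula.iAlls (Fin 1) (P.imp (substVar P Sum.inl (tSucc (Term.var (Sum.inr 0)))))).imp
      (Formula.iAlls (Fin 1) P)))

/-- The axioms of Peano arithmetic. -/
inductive PAAxiom : LA.Sentence → Prop
  | q {A : LA.Sentence} : QAxiom A → PAAxiom A
  | ind {n : ℕ} (P : LA.Formula (Fin n ⊕ Fin 1)) : PAAxiom (inductionAxiom P)

/-- Peano arithmetic: all logical consequences of its axioms. -/
def PA : Set LA.Sentence := {A | FirstOrder.Language.Theory.ModelsBoundedFormula {B | PAAxiom B} A}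

/-! ### Gödel numbers

The quantifiers of `BoundedFormula` bind variables by level: inside `n` quantifiers the bound
variables are `&0, …, &(n-1)`. -/

/-- The Gödel number of a term whose variables are `&0, …, &(n-1)`. -/
def termCode {n : ℕ} : LA.Term (Empty ⊕ Fin n) → ℕ
  | .var (.inl e) => e.elim
  | .var (.inr i) => Nat.pair 0 i
  | .func Func.zero _ => Nat.pair 1 0
  | .func Func.succ ts => Nat.pair 2 (termCode (ts 0))
  | .func Func.add ts => Nat.pair 3 (Nat.pair (termCode (ts 0)) (termCode (ts 1)))
  | .func Func.mul ts => Nat.pair 4 (Nat.pair (termCode (ts 0)) (termCode (ts 1)))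

/-- The Gödel number of a formula whose variables are all of the form `&i`. -/
def formulaCode : {n : ℕ} → LA.BoundedFormula Empty n → ℕ
  | _, .falsum => Nat.pair 0 0
  | _, .equal t u => Nat.pair 1 (Nat.pair (termCode t) (termCode u))
  | _, .rel r _ => Empty.elim r
  | _, .imp A B => Nat.pair 2 (Nat.pair (formulaCode A) (formulaCode B))
  | _, .all A => Nat.pair 3 (formulaCode A)

/-- The Gödel number of a sentence. -/
def code (A : LA.Sentence) : ℕ := formulaCode A

/-! ### Computably enumerable theories -/

/-- `pc` is a proof verifier for `T`: if `T` proves `A` then `pc` accepts some `p` as a proof of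
`A`, and otherwise it accepts none. -/
def IsProofVerifier (pc : ℕ → ℕ → Bool) (T : Set LA.Sentence) : Prop :=
  ∀ A : LA.Sentence,
    (A ∈ T → ∃ p, pc p (code A) = true) ∧ (A ∉ T → ∀ p, pc p (code A) = false)

/-- `T` is computably enumerable: it has a computable proof verifier. -/
def IsCE (T : Set LA.Sentence) : Prop :=
  ∃ pc : ℕ → ℕ → Bool, Computable₂ pc ∧ IsProofVerifier pc T

/-! ### Provability predicates -/

/-- A predicate: a formula with one free variable. -/
abbrev Predicate := LA.Formula (Fin 1)

/-- The sentence `P(⌜A⌝)`, where the numeral of the Gödel number of `A` is put for the free variable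
of `P`. -/
def Predicate.ofSentence (P : Predicate) (A : LA.Sentence) : LA.Sentence :=
  BoundedFormula.subst P (fun _ => numeral (code A))

/-- `P` is a provability predicate for `T` (correctness): `P(⌜A⌝)` is true in the intended
interpretation if and only if `T` proves `A`. -/
def IsProvabilityPredicate (P : Predicate) (T : Set LA.Sentence) : Prop :=
  ∀ A : LA.Sentence, IsTrue (P.ofSentence A) ↔ A ∈ T

/-- The Hilbert–Bernays–Löb derivability conditions. -/
structure DerivabilityConditions (P : Predicate) (T : Set LA.Sentence) : Prop where
  representability : ∀ A : LA.Sentence, A ∈ T → P.ofSentence A ∈ T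
  distributivity : ∀ A B : LA.Sentence,
    (P.ofSentence (A.imp B)).imp ((P.ofSentence A).imp (P.ofSentence B)) ∈ T
  reRepresentability : ∀ A : LA.Sentence,
    (P.ofSentence A).imp (P.ofSentence (P.ofSentence A)) ∈ T

/-- `P` is a strong provability predicate for `T`. -/
structure IsStrongProvabilityPredicate (P : Predicate) (T : Set LA.Sentence) : Prop where
  correct : IsProvabilityPredicate P T
  derivability : DerivabilityConditions P T

end Arith

/-! The last two derivability conditions are built into the predicate instead of being extracted
from arithmetized proofs. Let θ define in ℕ the set of codes of theorems of T, and let Pvb(x) be C →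
θ(x), where C says that the set defined by θ is closed under modus ponens and under passing from ⌜A⌝
to ⌜Pvb(⌜A⌝)⌝. In any model of T, assuming C makes distributivity and re-representability immediate.
If A ∈ T, then θ(⌜A⌝) holds in every model of Robinson arithmetic, so representability holds whether
or not C does. Finally C is true in ℕ: T is closed under modus ponens, and its closure under
necessitation is the representability just obtained. Hence Pvb(x) amounts to θ(x) in ℕ, which is
correctness.

C mentions Pvb, so a formula Q(x, u) is written first, with u a parameter, and Pvb(x) is Q(x, ⌜Q⌝).
The map from ⌜A⌝ to ⌜Pvb(⌜A⌝)⌝ is then the primitive recursive `diagonalCode`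
(`code_guardedPredicate`).

The arithmetic needed is Σ₁-completeness of Robinson arithmetic: graphs of partial recursive
functions have definitions whose true instances hold in all its models (`SigmaOneFun.of_partrec`, by
Gödel's β function). To define the theorems, codes of sentences must also be decidable
(`formulaBound_eq_zero_iff`). -/

namespace Arith

open FirstOrder FirstOrder.Language

/-! ### Structures for the language of arithmetic -/

section Structures

variable {α : Type} (M : Type) [LA.Structure M]

/-- The interpretation of `0`. -/
def mZero : M := Structure.funMap (L := LA) Func.zero ![]

variable {M}

/-- The interpretation of `S`. -/
def mSucc (a : M) : M := Structure.funMap (L := LA) Func.succ ![a]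

/-- The interpretation of `+`. -/
def mAdd (a b : M) : M := Structure.funMap (L := LA) Func.add ![a, b]

/-- The interpretation of `×`. -/
def mMul (a b : M) : M := Structure.funMap (L := LA) Func.mul ![a, b]

variable (M) in
/-- The interpretation of the numerals. -/
def mNum : ℕ → M
  | 0 => mZero M
  | n + 1 => mSucc (mNum n)

@[simp]
theorem realize_tZero (v : α → M) : (tZero : LA.Term α).realize v = mZero M := by
  simp only [tZero, Term.realize, mZero]
  congr 1
  ext i
  exact i.elim0

@[simp]
theorem realize_tSucc (t : LA.Term α) (v : α → M) :
    (tSucc t).realize v = mSucc (t.realize v) := by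
  simp only [tSucc, Term.realize, mSucc]
  congr 1
  ext i
  fin_cases i
  rfl

@[simp]
theorem realize_tAdd (t u : LA.Term α) (v : α → M) :
    (tAdd t u).realize v = mAdd (t.realize v) (u.realize v) := by
  simp only [tAdd, Term.realize, mAdd]
  congr 1
  ext i
  fin_cases i <;> rfl

@[simp]
theorem realize_tMul (t u : LA.Term α) (v : α → M) :
    (tMul t u).realize v = mMul (t.realize v) (u.realize v) := by
  simp only [tMul, Term.realize, mMul]
  congr 1
  ext i
  fin_cases i <;> rfl

@[simp]
theorem realize_numeral (n : ℕ) (v : α → M) :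
    (numeral n : LA.Term α).realize v = mNum M n := by
  induction n with
  | zero => exact realize_tZero v
  | succ n ih => simp only [numeral, realize_tSucc, ih, mNum]

@[simp] theorem mZero_nat : mZero ℕ = 0 := rfl
@[simp] theorem mSucc_nat (a : ℕ) : mSucc a = a + 1 := rfl
@[simp] theorem mAdd_nat (a b : ℕ) : mAdd a b = a + b := rfl
@[simp] theorem mMul_nat (a b : ℕ) : mMul a b = a * b := rfl

@[simp]
theorem mNum_nat (n : ℕ) : mNum ℕ n = n := by
  induction n with
  | zero => rfl
  | succ n ih => simp [mNum, ih]

variable (M) in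
/-- The structure `M` is a model of Robinson arithmetic. -/
structure IsQModel : Prop where
  succ_ne_zero : ∀ a : M, mSucc a ≠ mZero M
  succ_inj : ∀ a b : M, mSucc a = mSucc b → a = b
  eq_zero_or_succ : ∀ a : M, a = mZero M ∨ ∃ b, mSucc b = a
  add_zero : ∀ a : M, mAdd a (mZero M) = a
  add_succ : ∀ a b : M, mAdd a (mSucc b) = mSucc (mAdd a b)
  mul_zero : ∀ a : M, mMul a (mZero M) = mZero M
  mul_succ : ∀ a b : M, mMul a (mSucc b) = mAdd a (mMul a b)

theorem isQModel_of_qAxiom (h : ∀ A, QAxiom A → M ⊨ A) : IsQModel M where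
  succ_ne_zero := by
    simpa [Sentence.Realize, Formula.Realize, Fin.snoc] using h _ .s0
  succ_inj := by
    simpa [Sentence.Realize, Formula.Realize, Fin.snoc] using h _ .s1
  eq_zero_or_succ := by
    simpa [Sentence.Realize, Formula.Realize, Fin.snoc] using h _ .s2
  add_zero := by
    simpa [Sentence.Realize, Formula.Realize, Fin.snoc] using h _ .a0
  add_succ := by
    simpa [Sentence.Realize, Formula.Realize, Fin.snoc] using h _ .a1
  mul_zero := by
    simpa [Sentence.Realize, Formula.Realize, Fin.snoc] using h _ .m0
  mul_succ := by
    simpa [Sentence.Realize, Formula.Realize, Fin.snoc] using h _ .m1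

theorem IsQModel.mAdd_num (h : IsQModel M) (a b : ℕ) :
    mAdd (mNum M a) (mNum M b) = mNum M (a + b) := by
  induction b with
  | zero => exact h.add_zero _
  | succ b ih => rw [mNum, h.add_succ, ih, ← add_assoc, mNum]

theorem IsQModel.mMul_num (h : IsQModel M) (a b : ℕ) :
    mMul (mNum M a) (mNum M b) = mNum M (a * b) := by
  induction b with
  | zero => exact h.mul_zero _
  | succ b ih => rw [mNum, h.mul_succ, ih, h.mAdd_num, Nat.mul_succ, Nat.add_comm]

/-- The elements below a numeral are numerals. -/
theorem IsQModel.eq_num_of_add_succ_eq (h : IsQModel M) {n : ℕ} :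
    ∀ {a b : M}, mAdd a (mSucc b) = mNum M n → ∃ k < n, a = mNum M k := by
  induction n with
  | zero =>
    intro a b hab
    rw [h.add_succ] at hab
    exact (h.succ_ne_zero _ hab).elim
  | succ n ih =>
    intro a b hab
    rw [h.add_succ] at hab
    have hab := h.succ_inj _ _ hab
    rcases h.eq_zero_or_succ b with rfl | ⟨c, rfl⟩
    · exact ⟨n, n.lt_succ_self, by rw [← hab, h.add_zero]⟩
    · obtain ⟨k, hk, rfl⟩ := ih hab
      exact ⟨k, hk.trans n.lt_succ_self, rfl⟩

/-- The numerals form a homomorphic image of ℕ in M, so true equations between terms persist in M.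
-/
theorem IsQModel.realize_num (h : IsQModel M) (t : LA.Term α) (v : α → ℕ) :
    t.realize (fun i => mNum M (v i)) = mNum M (t.realize v) := by
  induction t with
  | var i => rfl
  | func f ts ih =>
    simp only [Term.realize, ih]
    cases f with
    | zero =>
      change _ = mZero M
      unfold mZero; congr 1; ext i; exact i.elim0
    | succ =>
      change _ = mSucc (mNum M ((ts 0).realize v))
      unfold mSucc; congr 1; ext i; fin_cases i; rfl
    | add =>
      change _ = mNum M ((ts 0).realize v + (ts 1).realize v)
      rw [← h.mAdd_num]
      unfold mAdd; congr 1; ext i; fin_cases i <;> rfl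
    | mul =>
      change _ = mNum M ((ts 0).realize v * (ts 1).realize v)
      rw [← h.mMul_num]
      unfold mMul; congr 1; ext i; fin_cases i <;> rfl

end Structures

/-! ### Definable relations that are complete for Robinson arithmetic -/

section SigmaOne

variable {α β : Type}

/-- The formula `φ` defines the relation `R` in `ℕ`, and every true instance of `R` holds in all
models of Robinson arithmetic. -/
def Represents (φ : LA.Formula α) (R : (α → ℕ) → Prop) : Prop :=
  (∀ v : α → ℕ, φ.Realize v ↔ R v) ∧
    ∀ (M : Type) [LA.Structure M], IsQModel M → ∀ v, R v → φ.Realize fun i => mNum M (v i)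

/-- The relation `R` is represented by some formula. -/
def SigmaOne (R : (α → ℕ) → Prop) : Prop := ∃ φ : LA.Formula α, Represents φ R

/-- The function `f` is given by a term. -/
def TermFun (f : (α → ℕ) → ℕ) : Prop := ∃ t : LA.Term α, ∀ v : α → ℕ, t.realize v = f v

namespace TermFun

theorem var (i : α) : TermFun fun v : α → ℕ => v i := ⟨Term.var i, fun _ => rfl⟩

theorem const (n : ℕ) : TermFun fun _ : α → ℕ => n := ⟨numeral n, fun v => by simp⟩

theorem add {f g : (α → ℕ) → ℕ} : TermFun f → TermFun g → TermFun fun v => f v + g v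
  | ⟨t, ht⟩, ⟨u, hu⟩ => ⟨tAdd t u, fun v => by simp [ht, hu]⟩

theorem mul {f g : (α → ℕ) → ℕ} : TermFun f → TermFun g → TermFun fun v => f v * g v
  | ⟨t, ht⟩, ⟨u, hu⟩ => ⟨tMul t u, fun v => by simp [ht, hu]⟩

end TermFun

namespace SigmaOne

theorem of_iff {R S : (α → ℕ) → Prop} (hR : SigmaOne R) (h : ∀ v, S v ↔ R v) : SigmaOne S := by
  rwa [show S = R from funext fun v => propext (h v)]

theorem reindex {R : (α → ℕ) → Prop} (hR : SigmaOne R) (e : α → β) :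
    SigmaOne fun v : β → ℕ => R fun i => v (e i) := by
  obtain ⟨φ, h₁, h₂⟩ := hR
  refine ⟨φ.relabel e, fun v => ?_, fun M _ hM v hv => ?_⟩
  · rw [Formula.realize_relabel, h₁]
    rfl
  · rw [Formula.realize_relabel]
    exact h₂ M hM _ hv

theorem eq {f g : (α → ℕ) → ℕ} (hf : TermFun f) (hg : TermFun g) :
    SigmaOne fun v => f v = g v := by
  obtain ⟨t, ht⟩ := hf
  obtain ⟨u, hu⟩ := hg
  refine ⟨Term.equal t u, fun v => ?_, fun M _ hM v hv => ?_⟩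
  · rw [Formula.realize_equal, ht, hu]
  · rw [Formula.realize_equal, hM.realize_num, hM.realize_num, ht, hu, hv]

theorem and {R S : (α → ℕ) → Prop} (hR : SigmaOne R) (hS : SigmaOne S) :
    SigmaOne fun v => R v ∧ S v := by
  obtain ⟨φ, h₁, h₂⟩ := hR
  obtain ⟨ψ, k₁, k₂⟩ := hS
  refine ⟨φ ⊓ ψ, fun v => ?_, fun M _ hM v hv => ?_⟩
  · rw [Formula.realize_inf, h₁, k₁]
  · rw [Formula.realize_inf]
    exact ⟨h₂ M hM v hv.1, k₂ M hM v hv.2⟩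

theorem or {R S : (α → ℕ) → Prop} (hR : SigmaOne R) (hS : SigmaOne S) :
    SigmaOne fun v => R v ∨ S v := by
  obtain ⟨φ, h₁, h₂⟩ := hR
  obtain ⟨ψ, k₁, k₂⟩ := hS
  refine ⟨φ ⊔ ψ, fun v => ?_, fun M _ hM v hv => ?_⟩
  · rw [Formula.realize_sup, h₁, k₁]
  · rw [Formula.realize_sup]
    exact hv.imp (h₂ M hM v) (k₂ M hM v)

/-- The assignment `v` extended by a value for the new variable `none`. -/
def extend {M : Type} (v : α → M) (x : M) : Option α → M := fun i => i.elim x v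

/-- Make the variable `none` the variable to be quantified by `Formula.iExs` or
`Formula.iAlls`. -/
def splitNone : Option α → α ⊕ Fin 1 := fun i => i.elim (Sum.inr 0) Sum.inl

theorem elim_comp_splitNone {M : Type} (v : α → M) (w : Fin 1 → M) :
    Sum.elim v w ∘ splitNone = extend v (w 0) := by
  ext i
  cases i <;> rfl

theorem extend_num {M : Type} [LA.Structure M] (v : α → ℕ) (x : ℕ) :
    (extend (fun i => mNum M (v i)) (mNum M x)) = fun i => mNum M (extend v x i) := by
  ext i
  cases i <;> rfl

theorem ex {R : (α → ℕ) → ℕ → Prop}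
    (hR : SigmaOne fun v : Option α → ℕ => R (fun i => v (some i)) (v none)) :
    SigmaOne fun v => ∃ x, R v x := by
  obtain ⟨φ, h₁, h₂⟩ := hR
  refine ⟨Formula.iExs (Fin 1) (φ.relabel splitNone), fun v => ?_, fun M _ hM v => ?_⟩
  · simp only [Formula.realize_iExs, Formula.realize_relabel, elim_comp_splitNone, h₁]
    exact ⟨fun ⟨w, hw⟩ => ⟨w 0, hw⟩, fun ⟨x, hx⟩ => ⟨fun _ => x, hx⟩⟩
  · rintro ⟨x, hx⟩
    simp only [Formula.realize_iExs, Formula.realize_relabel, elim_comp_splitNone]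
    refine ⟨fun _ => mNum M x, ?_⟩
    rw [extend_num]
    exact h₂ M hM (extend v x) hx

theorem lt {f g : (α → ℕ) → ℕ} (hf : TermFun f) (hg : TermFun g) :
    SigmaOne fun v => f v < g v := by
  obtain ⟨t, ht⟩ := hf
  obtain ⟨u, hu⟩ := hg
  refine of_iff (R := fun v => ∃ x, f v + (x + 1) = g v) (ex (eq ?_ ?_)) fun v => ?_
  · exact .add ⟨t.relabel some, fun v => by rw [Term.realize_relabel, ht]; rfl⟩
      (.add (.var none) (.const 1))
  · exact ⟨u.relabel some, fun v => by rw [Term.realize_relabel, hu]; rfl⟩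
  · exact ⟨fun h => ⟨g v - f v - 1, by omega⟩, fun ⟨x, hx⟩ => by omega⟩

/-- Elements of M below a numeral are numerals, so a bounded quantifier has no nonstandard instances
to check. The order is expressed by x + S b = n. -/
theorem ball {R : (α → ℕ) → ℕ → Prop} (n : α)
    (hR : SigmaOne fun v : Option α → ℕ => R (fun i => v (some i)) (v none)) :
    SigmaOne fun v => ∀ x < v n, R v x := by
  obtain ⟨φ, h₁, h₂⟩ := hR
  let below : LA.Formula (α ⊕ Fin 1) := Formula.iExs (Fin 1)
    (Term.equal (tAdd (Term.var (.inl (.inr 0))) (tSucc (Term.var (.inr 0))))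
      (Term.var (.inl (.inl n))))
  have hb {M : Type} [LA.Structure M] (v : α → M) (w : Fin 1 → M) :
      below.Realize (Sum.elim v w) ↔ ∃ b, mAdd (w 0) (mSucc b) = v n := by
    simp only [below, Formula.realize_iExs, Formula.realize_equal, realize_tAdd, realize_tSucc,
      Term.realize_var, Sum.elim_inl, Sum.elim_inr]
    exact ⟨fun ⟨w, hw⟩ => ⟨w 0, hw⟩, fun ⟨x, hx⟩ => ⟨fun _ => x, hx⟩⟩
  refine ⟨Formula.iAlls (Fin 1) (below.imp (φ.relabel splitNone)), fun v => ?_,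
    fun M _ hM v hv => ?_⟩
  · simp only [Formula.realize_iAlls, Formula.realize_imp, Formula.realize_relabel,
      elim_comp_splitNone, h₁, hb]
    constructor
    · intro h x hx
      exact h (fun _ => x) ⟨v n - x - 1, by simp only [mAdd_nat, mSucc_nat]; omega⟩
    · rintro h w ⟨b, hb⟩
      simp only [mAdd_nat, mSucc_nat] at hb
      exact h (w 0) (by omega)
  · simp only [Formula.realize_iAlls, Formula.realize_imp, Formula.realize_relabel,
      elim_comp_splitNone, hb]
    rintro w ⟨b, hb⟩
    obtain ⟨k, hk, hw⟩ := hM.eq_num_of_add_succ_eq hb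
    rw [hw, extend_num]
    exact h₂ M hM (extend v k) (hv k hk)

end SigmaOne

end SigmaOne

/-! ### Partial recursive functions are representable -/

section PartialRecursive

variable {α : Type}

theorem TermFun.lift {f : (α → ℕ) → ℕ} (hf : TermFun f) :
    TermFun fun v : Option α → ℕ => f fun i => v (some i) := by
  obtain ⟨t, ht⟩ := hf
  exact ⟨t.relabel some, fun v => by rw [Term.realize_relabel, ht]; rfl⟩

/-- The two cases of `Nat.pair` are written positively: g < f + 1 replaces the negation of f < g,
because true negations need not persist in models. -/
theorem SigmaOne.eq_pair {f g h : (α → ℕ) → ℕ} (hf : TermFun f) (hg : TermFun g)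
    (hh : TermFun h) : SigmaOne fun v => h v = Nat.pair (f v) (g v) := by
  refine of_iff (((lt hf hg).and (eq hh ((hg.mul hg).add hf))).or
    ((lt hg (hf.add (.const 1))).and (eq hh (((hf.mul hf).add hf).add hg)))) fun v => ?_
  rw [Nat.pair]
  split_ifs with h <;> omega

/-- Naming the quotient q and bounding the remainder turns the remainder operation into polynomial
equations and an inequality. -/
theorem eq_beta_iff (c i z : ℕ) : z = Nat.beta c i ↔
    ∃ a b q, c = Nat.pair a b ∧ a = q * ((i + 1) * b + 1) + z ∧ z < (i + 1) * b + 1 := by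
  constructor
  · rintro rfl
    refine ⟨c.unpair.1, c.unpair.2, c.unpair.1 / ((i + 1) * c.unpair.2 + 1),
      (Nat.pair_unpair c).symm, ?_, Nat.mod_lt _ (Nat.succ_pos _)⟩
    rw [mul_comm, Nat.beta, Nat.div_add_mod]
  · rintro ⟨a, b, q, rfl, rfl, hz⟩
    rw [Nat.beta, Nat.unpair_pair, mul_comm, Nat.mul_add_mod, Nat.mod_eq_of_lt hz]

theorem SigmaOne.eq_beta {f g h : (α → ℕ) → ℕ} (hf : TermFun f) (hg : TermFun g)
    (hh : TermFun h) : SigmaOne fun v => h v = Nat.beta (f v) (g v) := by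
  refine of_iff (ex (ex (ex (and ?_ (and ?_ ?_))))) fun v => eq_beta_iff _ _ _
  · exact eq_pair (.var (some (some none))) (.var (some none)) hf.lift.lift.lift
  · exact eq (.var (some (some none))) (.add (.mul (.var none)
      (.add (.mul (.add hg.lift.lift.lift (.const 1)) (.var (some none))) (.const 1)))
      hh.lift.lift.lift)
  · exact lt hh.lift.lift.lift
      (.add (.mul (.add hg.lift.lift.lift (.const 1)) (.var (some none))) (.const 1))

/-- Gödel's β lemma: by the Chinese remainder theorem one number codes any finite sequence. -/
theorem exists_beta_eq (s : ℕ → ℕ) (n : ℕ) : ∃ c, ∀ i ≤ n, Nat.beta c i = s i := by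
  refine ⟨Nat.unbeta ((List.range (n + 1)).map s), fun i hi => ?_⟩
  have := Nat.beta_unbeta_coe ((List.range (n + 1)).map s) ⟨i, by simp; omega⟩
  simpa using this

/-- A recursion is replaced by one number coding all its intermediate values, which leaves only an
existential and a bounded universal quantifier. -/
theorem mem_rec_iff (f : Part ℕ) (g : ℕ → ℕ → Part ℕ) (n y : ℕ) :
    y ∈ (Nat.rec f (fun i ih => ih.bind (g i)) n : Part ℕ) ↔
      ∃ c, Nat.beta c 0 ∈ f ∧ (∀ i < n, Nat.beta c (i + 1) ∈ g i (Nat.beta c i)) ∧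
        y = Nat.beta c n := by
  constructor
  · intro h
    -- The induction builds an uncoded sequence, which is easy to extend by one value; it is coded
    -- only once, at the end.
    suffices H : ∃ s : ℕ → ℕ, s 0 ∈ f ∧ (∀ i < n, s (i + 1) ∈ g i (s i)) ∧ y = s n by
      obtain ⟨s, h₀, h₁, rfl⟩ := H
      obtain ⟨c, hc⟩ := exists_beta_eq s n
      refine ⟨c, by rwa [hc 0 (Nat.zero_le _)], fun i hi => ?_, (hc n le_rfl).symm⟩
      rw [hc i hi.le, hc (i + 1) hi]
      exact h₁ i hi
    induction n generalizing y with
    | zero => exact ⟨fun _ => y, h, by simp, rfl⟩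
    | succ n ih =>
      obtain ⟨z, hz, hy⟩ := Part.mem_bind_iff.1 h
      obtain ⟨s, h₀, h₁, rfl⟩ := ih z hz
      refine ⟨fun i => if i ≤ n then s i else y, by simpa using h₀, fun i hi => ?_, by simp⟩
      rcases Nat.lt_succ_iff_lt_or_eq.1 hi with hi | rfl
      · simpa [hi.le, Nat.succ_le_iff.2 hi] using h₁ i hi
      · simpa using hy
  · rintro ⟨c, h₀, h₁, rfl⟩
    induction n with
    | zero => exact h₀
    | succ n ih =>
      exact Part.mem_bind_iff.2 ⟨_, ih fun i hi => h₁ i (hi.trans n.lt_succ_self),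
        h₁ n n.lt_succ_self⟩

/-- The graph of `f` is represented. -/
def SigmaOneFun (f : ℕ →. ℕ) : Prop := SigmaOne fun v : Fin 2 → ℕ => v 1 ∈ f (v 0)

theorem SigmaOneFun.mem {f : ℕ →. ℕ} (hf : SigmaOneFun f) (i j : α) :
    SigmaOne fun v : α → ℕ => v j ∈ f (v i) :=
  hf.reindex ![i, j]

open SigmaOne in
theorem SigmaOneFun.of_partrec {f : ℕ →. ℕ} (hf : Nat.Partrec f) : SigmaOneFun f := by
  induction hf with
  | zero =>
    exact of_iff (eq (.var 1) (.const 0)) fun v => Part.mem_some_iff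
  | succ =>
    exact of_iff (eq (.var 1) (.add (.var 0) (.const 1))) fun v => Part.mem_some_iff
  | left =>
    refine of_iff (R := fun v : Fin 2 → ℕ => ∃ b, v 0 = Nat.pair (v 1) b)
      (ex (eq_pair (.var _) (.var _) (.var _))) fun v => Part.mem_some_iff.trans ?_
    constructor
    · intro h
      exact ⟨(v 0).unpair.2, by rw [h, Nat.pair_unpair]⟩
    · rintro ⟨b, hb⟩
      simp [hb]
  | right =>
    refine of_iff (R := fun v : Fin 2 → ℕ => ∃ a, v 0 = Nat.pair a (v 1))
      (ex (eq_pair (.var _) (.var _) (.var _))) fun v => Part.mem_some_iff.trans ?_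
    constructor
    · intro h
      exact ⟨(v 0).unpair.1, by rw [h, Nat.pair_unpair]⟩
    · rintro ⟨b, hb⟩
      simp [hb]
  | @pair f g _ _ ihf ihg =>
    refine of_iff (R := fun v : Fin 2 → ℕ =>
        ∃ a b, a ∈ f (v 0) ∧ b ∈ g (v 0) ∧ v 1 = Nat.pair a b)
      (ex (ex ((ihf.mem _ _).and ((ihg.mem _ _).and (eq_pair (.var _) (.var _) (.var _))))))
      fun v => ?_
    simp only [Seq.seq, Part.map_eq_map, Part.mem_bind_iff, Part.mem_map_iff]
    constructor
    · rintro ⟨_, ⟨a, ha, rfl⟩, b, hb, h⟩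
      exact ⟨a, b, ha, hb, h.symm⟩
    · rintro ⟨a, b, ha, hb, h⟩
      exact ⟨_, ⟨a, ha, rfl⟩, b, hb, h.symm⟩
  | @comp f g _ _ ihf ihg =>
    exact of_iff (R := fun v : Fin 2 → ℕ => ∃ a, a ∈ g (v 0) ∧ v 1 ∈ f a)
      (ex ((ihg.mem _ _).and (ihf.mem _ _))) fun v => Part.mem_bind_iff
  | @prec f g _ _ ihf ihg =>
    -- Every intermediate value gets its own variable, since the induction hypotheses apply to
    -- variables and not to compound terms.
    refine of_iff (R := fun v : Fin 2 → ℕ => ∃ a n c, v 0 = Nat.pair a n ∧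
        (∃ z, z = Nat.beta c 0 ∧ z ∈ f a) ∧
        (∀ i < n, ∃ s t p q, s = Nat.beta c i ∧ t = Nat.beta c (i + 1) ∧ p = Nat.pair i s ∧
          q = Nat.pair a p ∧ t ∈ g q) ∧ v 1 = Nat.beta c n) ?_ fun v => ?_
    · refine ex (ex (ex (and ?_ (and (ex (and ?_ ?_)) (and
        (ball (some none) (ex (ex (ex (ex (and ?_ (and ?_ (and ?_ (and ?_ ?_))))))))) ?_)))))
      · exact eq_pair (.var _) (.var _) (.var _)
      · exact eq_beta (.var _) (.const 0) (.var _)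
      · exact ihf.mem _ _
      · exact eq_beta (.var _) (.var _) (.var _)
      · exact eq_beta (.var _) (.add (.var _) (.const 1)) (.var _)
      · exact eq_pair (.var _) (.var _) (.var _)
      · exact eq_pair (.var _) (.var _) (.var _)
      · exact ihg.mem _ _
      · exact eq_beta (.var _) (.var _) (.var _)
    · have h := mem_rec_iff (f (v 0).unpair.1)
        (fun i z => g (Nat.pair (v 0).unpair.1 (Nat.pair i z))) (v 0).unpair.2 (v 1)
      refine Iff.trans h ?_
      constructor
      · rintro ⟨c, h₀, h₁, h₂⟩
        exact ⟨_, _, c, (Nat.pair_unpair _).symm, ⟨_, rfl, h₀⟩,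
          fun i hi => ⟨_, _, _, _, rfl, rfl, rfl, rfl, h₁ i hi⟩, h₂⟩
      · rintro ⟨a, n, c, hv, ⟨_, rfl, h₀⟩, h₁, h₂⟩
        rw [hv, Nat.unpair_pair]
        refine ⟨c, h₀, fun i hi => ?_, h₂⟩
        obtain ⟨_, _, _, _, rfl, rfl, rfl, rfl, h⟩ := h₁ i hi
        exact h
  | @rfind f _ ihf =>
    -- At each earlier argument f must be defined and nonzero; writing the value as m + 1 avoids a
    -- negation.
    refine of_iff (R := fun v : Fin 2 → ℕ =>
        (∃ p z, p = Nat.pair (v 0) (v 1) ∧ z = 0 ∧ z ∈ f p) ∧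
        ∀ i < v 1, ∃ p z m, p = Nat.pair (v 0) i ∧ z = m + 1 ∧ z ∈ f p) ?_ fun v => ?_
    · refine and (ex (ex (and ?_ (and ?_ ?_)))) (ball _ (ex (ex (ex (and ?_ (and ?_ ?_))))))
      · exact eq_pair (.var _) (.var _) (.var _)
      · exact eq (.var _) (.const 0)
      · exact ihf.mem _ _
      · exact eq_pair (.var _) (.var _) (.var _)
      · exact eq (.var _) (.add (.var _) (.const 1))
      · exact ihf.mem _ _
    · refine Nat.mem_rfind.trans ?_
      simp only [Part.map_eq_map, Part.mem_map_iff, decide_eq_true_eq, decide_eq_false_iff_not]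
      refine and_congr ?_ (forall₂_congr fun i hi => ?_)
      · constructor
        · rintro ⟨z, hz, rfl⟩
          exact ⟨_, _, rfl, rfl, hz⟩
        · rintro ⟨_, z, rfl, rfl, hz⟩
          exact ⟨_, hz, rfl⟩
      · constructor
        · rintro ⟨z, hz, h⟩
          exact ⟨_, z, z - 1, rfl, by omega, hz⟩
        · rintro ⟨_, z, m, rfl, rfl, hz⟩
          exact ⟨_, hz, by omega⟩

/-- The graph of a computable function is represented. -/
theorem SigmaOne.eq_computable {b : ℕ → ℕ} (hb : Computable b) (i j : α) :
    SigmaOne fun v : α → ℕ => v j = b (v i) :=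
  of_iff ((SigmaOneFun.of_partrec (Partrec.nat_iff.1 hb)).mem i j) fun _ =>
    Part.mem_some_iff.symm

end PartialRecursive

/-! ### The set of codes of sentences is decidable -/

section CourseOfValues

variable {σ : Type}

/-- The list of the first `n` values of the function defined by course-of-values recursion. -/
def history (step : List σ → σ) : ℕ → List σ
  | 0 => []
  | n + 1 => history step n ++ [step (history step n)]

/-- The function `f` with `f n = step [f 0, …, f (n - 1)]`. -/
def courseRec (step : List σ → σ) (n : ℕ) : σ := step (history step n)

@[simp]
theorem length_history (step : List σ → σ) (n : ℕ) : (history step n).length = n := by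
  induction n with
  | zero => rfl
  | succ n ih => simp [history, ih]

theorem getD_history (step : List σ → σ) (d : σ) {m n : ℕ} (h : m < n) :
    (history step n).getD m d = courseRec step m := by
  induction n with
  | zero => omega
  | succ n ih =>
    rcases Nat.lt_succ_iff_lt_or_eq.1 h with h | rfl
    · rw [history, List.getD_append _ _ _ _ (by simpa using h), ih h]
    · simp [history, courseRec, List.getD]

theorem primrec_courseRec [Primcodable σ] {step : List σ → σ} (h : Primrec step) :
    Primrec (courseRec step) := by
  have : Primrec (history step) := by
    refine (Primrec.nat_rec' (f := fun n : ℕ => n) (g := fun _ => ([] : List σ))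
      (h := fun _ p => p.2 ++ [step p.2]) .id (.const _) ?_).of_eq fun n => ?_
    · have h₂ : Primrec fun q : ℕ × ℕ × List σ => q.2.2 := Primrec.snd.comp .snd
      exact Primrec.list_append.comp h₂
        (Primrec.list_cons.comp (h.comp h₂) (.const []))
    · induction n with
      | zero => rfl
      | succ n ih => simp_all [history]
  exact h.comp this

end CourseOfValues

/-! ### Primitive recursive recognition of codes of terms and formulas. -/

section Bounds

/-- The maximum of two optional numbers, if both are there. -/
def maxBoth (a b : Option ℕ) : Option ℕ := a.bind fun x => b.map fun y => max x y

theorem maxBoth_eq_some {a b : Option ℕ} {k : ℕ} :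
    maxBoth a b = some k ↔ ∃ x y, a = some x ∧ b = some y ∧ max x y = k := by
  cases a <;> cases b <;> simp [maxBoth]

theorem primrec_maxBoth : Primrec₂ maxBoth :=
  Primrec.option_bind .fst (Primrec.option_map (Primrec.snd.comp .fst)
    (Primrec.nat_max.comp (Primrec.snd.comp .fst) .snd))

/-- The recursion step of `termBound`. -/
def termStep (l : List (Option ℕ)) : Option ℕ :=
  -- The list holds the values at all smaller numbers, so its length is the number under
  -- examination; t is its tag and m its payload.
  let t := l.length.unpair.1
  let m := l.length.unpair.2
  if t = 0 then some (m + 1)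
  else if t = 1 then (if m = 0 then some 0 else none)
  else if t = 2 then l.getD m none
  else if t ≤ 4 then maxBoth (l.getD m.unpair.1 none) (l.getD m.unpair.2 none)
  else none

/-- The least `n` such that the number is the code of a term with variables `&0, …, &(n-1)`. -/
def termBound : ℕ → Option ℕ := courseRec termStep

/-- The recursion step of `formulaBound`. -/
def formulaStep (l : List (Option ℕ)) : Option ℕ :=
  let t := l.length.unpair.1
  let m := l.length.unpair.2
  if t = 0 then (if m = 0 then some 0 else none)
  else if t = 1 then maxBoth (termBound m.unpair.1) (termBound m.unpair.2)
  else if t = 2 then maxBoth (l.getD m.unpair.1 none) (l.getD m.unpair.2 none)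
  -- The bound variable is the one of highest level. The predecessor is truncated because a vacuous
  -- quantifier leaves bound 0 unchanged.
  else if t = 3 then (l.getD m none).map Nat.pred
  else none

/-- The least `n` such that the number is the code of a formula with free variables
`&0, …, &(n-1)`. -/
def formulaBound : ℕ → Option ℕ := courseRec formulaStep

theorem primrec_termBound : Primrec termBound := by
  refine primrec_courseRec ?_
  have hu : Primrec fun l : List (Option ℕ) => l.length.unpair :=
    Primrec.unpair.comp .list_length
  have ht := Primrec.fst.comp hu
  have hm := Primrec.snd.comp hu
  have hm₁ := Primrec.fst.comp (Primrec.unpair.comp hm)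
  have hm₂ := Primrec.snd.comp (Primrec.unpair.comp hm)
  have hd := Primrec.list_getD (none : Option ℕ)
  exact .ite (Primrec.eq.comp ht (.const 0)) (Primrec.option_some.comp (Primrec.succ.comp hm))
    (.ite (Primrec.eq.comp ht (.const 1))
      (.ite (Primrec.eq.comp hm (.const 0)) (.const (some 0)) (.const none))
    (.ite (Primrec.eq.comp ht (.const 2)) (hd.comp .id hm)
    (.ite (Primrec.nat_le.comp ht (.const 4))
      (primrec_maxBoth.comp (hd.comp .id hm₁) (hd.comp .id hm₂)) (.const none))))

theorem primrec_formulaBound : Primrec formulaBound := by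
  refine primrec_courseRec ?_
  have hu : Primrec fun l : List (Option ℕ) => l.length.unpair :=
    Primrec.unpair.comp .list_length
  have ht := Primrec.fst.comp hu
  have hm := Primrec.snd.comp hu
  have hm₁ := Primrec.fst.comp (Primrec.unpair.comp hm)
  have hm₂ := Primrec.snd.comp (Primrec.unpair.comp hm)
  have hd := Primrec.list_getD (none : Option ℕ)
  exact .ite (Primrec.eq.comp ht (.const 0))
      (.ite (Primrec.eq.comp hm (.const 0)) (.const (some 0)) (.const none))
    (.ite (Primrec.eq.comp ht (.const 1))
      (primrec_maxBoth.comp (primrec_termBound.comp hm₁) (primrec_termBound.comp hm₂))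
    (.ite (Primrec.eq.comp ht (.const 2))
      (primrec_maxBoth.comp (hd.comp .id hm₁) (hd.comp .id hm₂))
    (.ite (Primrec.eq.comp ht (.const 3))
      (Primrec.option_map (hd.comp .id hm) (Primrec.pred.comp .snd).to₂) (.const none))))

/-- A positive tag makes components strictly smaller than the code, so their values are in the
history; tag 0 never calls for recursion. -/
theorem snd_lt_pair {a b : ℕ} (h : 0 < a) : b < Nat.pair a b := by
  have := Nat.add_le_pair a b
  omega

theorem fst_lt_pair_pair {a b c : ℕ} (h : 0 < a) : b < Nat.pair a (Nat.pair b c) :=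
  (Nat.left_le_pair b c).trans_lt (snd_lt_pair h)

theorem snd_lt_pair_pair {a b c : ℕ} (h : 0 < a) : c < Nat.pair a (Nat.pair b c) :=
  (Nat.right_le_pair b c).trans_lt (snd_lt_pair h)

theorem termBound_var (m : ℕ) : termBound (Nat.pair 0 m) = some (m + 1) := by
  simp [termBound, courseRec, termStep]

theorem termBound_zero (m : ℕ) :
    termBound (Nat.pair 1 m) = if m = 0 then some 0 else none := by
  simp [termBound, courseRec, termStep]

theorem termBound_succ (m : ℕ) : termBound (Nat.pair 2 m) = termBound m := by
  rw [termBound, courseRec, termStep]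
  simp only [length_history, Nat.unpair_pair]
  exact getD_history termStep none (snd_lt_pair two_pos)

theorem termBound_binary {t : ℕ} (h : t = 3 ∨ t = 4) (a b : ℕ) :
    termBound (Nat.pair t (Nat.pair a b)) = maxBoth (termBound a) (termBound b) := by
  have ht : 0 < t := by omega
  rw [termBound, courseRec, termStep]
  simp only [length_history, Nat.unpair_pair, getD_history termStep none (fst_lt_pair_pair ht),
    getD_history termStep none (snd_lt_pair_pair ht)]
  rcases h with rfl | rfl <;> rfl

theorem termBound_of_gt {t : ℕ} (h : 4 < t) (m : ℕ) : termBound (Nat.pair t m) = none := by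
  rw [termBound, courseRec, termStep]
  simp only [length_history, Nat.unpair_pair]
  rw [if_neg (by omega), if_neg (by omega), if_neg (by omega), if_neg (by omega)]

theorem formulaBound_falsum (m : ℕ) :
    formulaBound (Nat.pair 0 m) = if m = 0 then some 0 else none := by
  simp [formulaBound, courseRec, formulaStep]

theorem formulaBound_equal (a b : ℕ) :
    formulaBound (Nat.pair 1 (Nat.pair a b)) = maxBoth (termBound a) (termBound b) := by
  simp [formulaBound, courseRec, formulaStep]

theorem formulaBound_imp (a b : ℕ) :
    formulaBound (Nat.pair 2 (Nat.pair a b)) = maxBoth (formulaBound a) (formulaBound b) := by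
  rw [formulaBound, courseRec, formulaStep]
  simp only [length_history, Nat.unpair_pair,
    getD_history formulaStep none (fst_lt_pair_pair two_pos),
    getD_history formulaStep none (snd_lt_pair_pair two_pos)]
  rfl

theorem formulaBound_all (m : ℕ) :
    formulaBound (Nat.pair 3 m) = (formulaBound m).map Nat.pred := by
  rw [formulaBound, courseRec, formulaStep]
  simp only [length_history, Nat.unpair_pair,
    getD_history formulaStep none (snd_lt_pair three_pos)]
  rfl

theorem formulaBound_of_gt {t : ℕ} (h : 3 < t) (m : ℕ) :
    formulaBound (Nat.pair t m) = none := by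
  rw [formulaBound, courseRec, formulaStep]
  simp only [length_history, Nat.unpair_pair]
  rw [if_neg (by omega), if_neg (by omega), if_neg (by omega), if_neg (by omega)]

theorem exists_termBound {n : ℕ} (t : LA.Term (Empty ⊕ Fin n)) :
    ∃ k ≤ n, termBound (termCode t) = some k := by
  induction t with
  | var i =>
    rcases i with e | i
    · exact e.elim
    · exact ⟨i + 1, i.2, termBound_var i⟩
  | func f ts ih =>
    cases f with
    | zero => exact ⟨0, Nat.zero_le n, by simp [termCode, termBound_zero]⟩
    | succ =>
      obtain ⟨k, hk, h⟩ := ih 0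
      exact ⟨k, hk, by rw [termCode, termBound_succ, h]⟩
    | add =>
      obtain ⟨k, hk, h⟩ := ih 0
      obtain ⟨l, hl, h'⟩ := ih 1
      exact ⟨max k l, max_le hk hl, by rw [termCode, termBound_binary (.inl rfl), h, h']; rfl⟩
    | mul =>
      obtain ⟨k, hk, h⟩ := ih 0
      obtain ⟨l, hl, h'⟩ := ih 1
      exact ⟨max k l, max_le hk hl, by rw [termCode, termBound_binary (.inr rfl), h, h']; rfl⟩

theorem exists_formulaBound {n : ℕ} (A : LA.BoundedFormula Empty n) :
    ∃ k ≤ n, formulaBound (formulaCode A) = some k := by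
  induction A with
  | falsum => exact ⟨0, Nat.zero_le _, by simp [formulaCode, formulaBound_falsum]⟩
  | equal t u =>
    obtain ⟨k, hk, h⟩ := exists_termBound t
    obtain ⟨l, hl, h'⟩ := exists_termBound u
    exact ⟨max k l, max_le hk hl, by rw [formulaCode, formulaBound_equal, h, h']; rfl⟩
  | rel r => exact Empty.elim r
  | imp A B ihA ihB =>
    obtain ⟨k, hk, h⟩ := ihA
    obtain ⟨l, hl, h'⟩ := ihB
    exact ⟨max k l, max_le hk hl, by rw [formulaCode, formulaBound_imp, h, h']; rfl⟩
  | all A ih =>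
    obtain ⟨k, hk, h⟩ := ih
    exact ⟨k - 1, by omega, by rw [formulaCode, formulaBound_all, h]; rfl⟩

theorem exists_pair_eq (c : ℕ) : ∃ a b, c = Nat.pair a b := ⟨_, _, (Nat.pair_unpair c).symm⟩

/-- The context n may exceed the least bound k, so that both arguments of a binary symbol can be
decoded in the same context. -/
theorem exists_termCode_eq (c : ℕ) : ∀ {k n : ℕ}, termBound c = some k → k ≤ n →
    ∃ t : LA.Term (Empty ⊕ Fin n), termCode t = c := by
  induction c using Nat.strong_induction_on with
  | _ c ih =>
    intro k n h hk
    obtain ⟨t, m, rfl⟩ := exists_pair_eq c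
    rcases lt_or_ge 4 t with ht | ht
    · rw [termBound_of_gt ht] at h
      cases h
    interval_cases t
    · rw [termBound_var, Option.some.injEq] at h
      exact ⟨Term.var (.inr ⟨m, by omega⟩), rfl⟩
    · rw [termBound_zero] at h
      split_ifs at h with hm
      exact ⟨tZero, by rw [hm]; rfl⟩
    · rw [termBound_succ] at h
      obtain ⟨u, hu⟩ := ih m (snd_lt_pair two_pos) h hk
      exact ⟨tSucc u, by rw [← hu]; rfl⟩
    · obtain ⟨a, b, rfl⟩ := exists_pair_eq m
      rw [termBound_binary (.inl rfl), maxBoth_eq_some] at h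
      obtain ⟨x, y, hx, hy, rfl⟩ := h
      obtain ⟨u, rfl⟩ := ih a (fst_lt_pair_pair three_pos) hx ((le_max_left _ _).trans hk)
      obtain ⟨w, rfl⟩ := ih b (snd_lt_pair_pair three_pos) hy ((le_max_right _ _).trans hk)
      exact ⟨tAdd u w, rfl⟩
    · obtain ⟨a, b, rfl⟩ := exists_pair_eq m
      rw [termBound_binary (.inr rfl), maxBoth_eq_some] at h
      obtain ⟨x, y, hx, hy, rfl⟩ := h
      obtain ⟨u, rfl⟩ := ih a (fst_lt_pair_pair four_pos) hx ((le_max_left _ _).trans hk)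
      obtain ⟨w, rfl⟩ := ih b (snd_lt_pair_pair four_pos) hy ((le_max_right _ _).trans hk)
      exact ⟨tMul u w, rfl⟩

theorem exists_formulaCode_eq (c : ℕ) : ∀ {k n : ℕ}, formulaBound c = some k → k ≤ n →
    ∃ A : LA.BoundedFormula Empty n, formulaCode A = c := by
  induction c using Nat.strong_induction_on with
  | _ c ih =>
    intro k n h hk
    obtain ⟨t, m, rfl⟩ := exists_pair_eq c
    rcases lt_or_ge 3 t with ht | ht
    · rw [formulaBound_of_gt ht] at h
      cases h
    interval_cases t
    · rw [formulaBound_falsum] at h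
      split_ifs at h with hm
      exact ⟨.falsum, by rw [hm]; rfl⟩
    · obtain ⟨a, b, rfl⟩ := exists_pair_eq m
      rw [formulaBound_equal, maxBoth_eq_some] at h
      obtain ⟨x, y, hx, hy, rfl⟩ := h
      obtain ⟨u, rfl⟩ := exists_termCode_eq a hx ((le_max_left _ _).trans hk)
      obtain ⟨w, rfl⟩ := exists_termCode_eq b hy ((le_max_right _ _).trans hk)
      exact ⟨.equal u w, rfl⟩
    · obtain ⟨a, b, rfl⟩ := exists_pair_eq m
      rw [formulaBound_imp, maxBoth_eq_some] at h
      obtain ⟨x, y, hx, hy, rfl⟩ := h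
      obtain ⟨A, rfl⟩ := ih a (fst_lt_pair_pair two_pos) hx ((le_max_left _ _).trans hk)
      obtain ⟨B, rfl⟩ := ih b (snd_lt_pair_pair two_pos) hy ((le_max_right _ _).trans hk)
      exact ⟨.imp A B, rfl⟩
    · rw [formulaBound_all, Option.map_eq_some_iff] at h
      obtain ⟨l, hl, rfl⟩ := h
      obtain ⟨A, rfl⟩ := ih m (snd_lt_pair three_pos) hl (n := n + 1) (by
        rw [Nat.pred_eq_sub_one] at hk; omega)
      exact ⟨.all A, rfl⟩

theorem formulaBound_eq_zero_iff (c : ℕ) :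
    formulaBound c = some 0 ↔ ∃ A : LA.Sentence, code A = c := by
  constructor
  · exact fun h => exists_formulaCode_eq c h le_rfl
  · rintro ⟨A, rfl⟩
    obtain ⟨k, hk, h⟩ := exists_formulaBound A
    rwa [Nat.le_zero.1 hk] at h

end Bounds

/-! ### Instances of formulas and their codes -/

section Instances

variable {α β : Type}

@[simp]
theorem numeral_subst (n : ℕ) (f : α → LA.Term β) :
    (numeral n : LA.Term α).subst f = numeral n := by
  induction n with
  | zero =>
    simp only [numeral, tZero, Term.subst]
    congr 1
    ext i
    exact i.elim0
  | succ n ih =>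
    simp only [numeral, tSucc, Term.subst] at ih ⊢
    congr 1
    ext i
    fin_cases i
    exact ih

@[simp]
theorem numeral_relabel (n : ℕ) (f : α → β) :
    (numeral n : LA.Term α).relabel f = numeral n := by
  induction n with
  | zero =>
    simp only [numeral, tZero, Term.relabel]
    congr 1
    ext i
    exact i.elim0
  | succ n ih =>
    simp only [numeral, tSucc, Term.relabel] at ih ⊢
    congr 1
    ext i
    fin_cases i
    exact ih

/-- The code of the numeral of `n`. -/
def numeralCode (n : ℕ) : ℕ := Nat.rec (Nat.pair 1 0) (fun _ c => Nat.pair 2 c) n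

theorem termCode_numeral {k : ℕ} (n : ℕ) :
    termCode (numeral n : LA.Term (Empty ⊕ Fin k)) = numeralCode n := by
  induction n with
  | zero => rfl
  | succ n ih => exact congrArg (Nat.pair 2) ih

theorem primrec_numeralCode : Primrec numeralCode :=
  Primrec.nat_rec₁ _ (Primrec₂.natPair.comp (.const 2) .snd)

/-- The sentence saying that `Q` holds of the numerals of `a` and `q`. -/
def instanceSentence (Q : LA.BoundedFormula Empty 2) (q a : ℕ) : LA.Sentence :=
  ∀' ((&0 =' numeral a) ⟹ ∀' ((&1 =' numeral q) ⟹ Q))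

/-- The predicate `Q(x, q)` of `x`, with the numeral of `q` as second argument. -/
def instancePredicate (Q : LA.BoundedFormula Empty 2) (q : ℕ) : Predicate :=
  ∀' ((&0 =' Term.var (.inl 0)) ⟹ ∀' ((&1 =' numeral q) ⟹ Q.subst fun e => e.elim))

/-- There are no free variables to replace; the two substitutions only change the type of free
variables and change it back. -/
theorem subst_subst_empty {n : ℕ} (Q : LA.BoundedFormula Empty n) (f : Empty → LA.Term α)
    (g : α → LA.Term Empty) : (Q.subst f).subst g = Q := by
  rw [BoundedFormula.subst, BoundedFormula.subst, BoundedFormula.mapTermRel_mapTermRel]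
  convert BoundedFormula.mapTermRel_id_id_id Q using 2
  · funext k t
    induction t with
    | var i =>
      rcases i with e | i
      · exact e.elim
      · rfl
    | func F ts ih => exact congrArg (Term.func F) (funext ih)
  · rfl

theorem ofSentence_instancePredicate (Q : LA.BoundedFormula Empty 2) (q : ℕ)
    (A : LA.Sentence) :
    (instancePredicate Q q).ofSentence A = instanceSentence Q q (code A) := by
  have h := subst_subst_empty Q (α := Fin 1) (fun e => e.elim) fun _ => numeral (code A)
  simp only [BoundedFormula.subst] at h
  simp [instancePredicate, instanceSentence, Predicate.ofSentence, BoundedFormula.subst,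
    BoundedFormula.mapTermRel, Term.bdEqual, Term.subst, h]

/-- The code of `Q(a, q)` where `q` is the code of `Q`. -/
def diagonalCode (q a : ℕ) : ℕ :=
  Nat.pair 3 (Nat.pair 2 (Nat.pair (Nat.pair 1 (Nat.pair (Nat.pair 0 0) (numeralCode a)))
    (Nat.pair 3 (Nat.pair 2
      (Nat.pair (Nat.pair 1 (Nat.pair (Nat.pair 0 1) (numeralCode q))) q)))))

/-- Fixing the arguments by equations under quantifiers leaves Q intact, so its code appears as one
block and no substitution function has to be computed on codes. -/
theorem code_instanceSentence (Q : LA.BoundedFormula Empty 2) (a : ℕ) :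
    code (instanceSentence Q (formulaCode Q) a) = diagonalCode (formulaCode Q) a := by
  simp [instanceSentence, code, formulaCode, diagonalCode, Term.bdEqual, termCode,
    termCode_numeral]

theorem primrec_diagonalCode : Primrec₂ diagonalCode := by
  have p {f g : ℕ × ℕ → ℕ} (hf : Primrec f) (hg : Primrec g) :
      Primrec fun x => Nat.pair (f x) (g x) := Primrec₂.natPair.comp hf hg
  exact p (.const 3) (p (.const 2) (p (p (.const 1) (p (.const _)
    (primrec_numeralCode.comp .snd))) (p (.const 3) (p (.const 2)
      (p (p (.const 1) (p (.const _) (primrec_numeralCode.comp .fst))) .fst)))))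

theorem realize_instanceSentence {M : Type} [LA.Structure M] (Q : LA.BoundedFormula Empty 2)
    (q a : ℕ) : M ⊨ instanceSentence Q q a ↔
      Q.Realize default ![mNum M a, mNum M q] := by
  have h (x y : M) : Fin.snoc (Fin.snoc (default : Fin 0 → M) x : Fin 1 → M) y = ![x, y] := by
    ext i
    fin_cases i <;> rfl
  simp only [instanceSentence, Sentence.Realize, Formula.Realize, BoundedFormula.realize_all,
    BoundedFormula.realize_imp, BoundedFormula.realize_bdEqual, realize_numeral, h]
  constructor
  · exact fun H => H _ rfl _ rfl
  · rintro H x hx y hy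
    have hx : x = mNum M a := hx
    have hy : y = mNum M q := hy
    rwa [hx, hy]

end Instances

/-! ### The provability predicate -/

section Provability

/-- The set of codes of theorems of a computably enumerable theory is represented. -/
theorem sigmaOne_theorems {T : Set LA.Sentence} (hT : IsCE T) :
    SigmaOne fun v : Fin 1 → ℕ => ∃ A ∈ T, code A = v 0 := by
  obtain ⟨pc, hpc, hv⟩ := hT
  -- A verifier is unconstrained on numbers that code no sentence, so acceptance is combined with
  -- the decidable test for codes of sentences.
  let b : ℕ → ℕ := fun m => Encodable.encode
    (pc m.unpair.1 m.unpair.2 && decide (formulaBound m.unpair.2 = some 0))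
  have hd : Computable fun c => decide (formulaBound c = some 0) :=
    (Primrec.eq.comp primrec_formulaBound (.const (some 0))).decide.to_comp
  have hu₁ : Computable fun m : ℕ => m.unpair.1 := Computable.fst.comp .unpair
  have hu₂ : Computable fun m : ℕ => m.unpair.2 := Computable.snd.comp .unpair
  have hb : Computable b := Computable.encode.comp
    (Primrec.and.to_comp.comp (hpc.comp hu₁ hu₂) (hd.comp hu₂))
  -- The value 1 encodes `true`.
  refine .of_iff (R := fun v : Fin 1 → ℕ => ∃ p m y, m = Nat.pair p (v 0) ∧ y = 1 ∧ y = b m)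
    (.ex (.ex (.ex (.and ?_ (.and ?_ ?_))))) fun v => ?_
  · exact .eq_pair (.var _) (.var _) (.var _)
  · exact .eq (.var _) (.const 1)
  · exact .eq_computable hb _ _
  · constructor
    · rintro ⟨A, hA, hc⟩
      obtain ⟨p, hp⟩ := (hv A).1 hA
      refine ⟨p, _, _, rfl, rfl, ?_⟩
      have := (formulaBound_eq_zero_iff (v 0)).2 ⟨A, hc⟩
      rw [← hc] at this ⊢
      simp [b, hp, this]
    · rintro ⟨p, _, _, rfl, rfl, h⟩
      have h : (pc p (v 0) && decide (formulaBound (v 0) = some 0)) = true :=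
        Encodable.encode_injective (by simpa [b] using h.symm)
      simp only [Bool.and_eq_true, decide_eq_true_eq] at h
      obtain ⟨A, hA⟩ := (formulaBound_eq_zero_iff (v 0)).1 h.2
      refine ⟨A, ?_, hA⟩
      by_contra hn
      have := (hv A).2 hn p
      rw [hA, h.1] at this
      cases this

/-- In one step, modus ponens leads from `x` and `y` to `z`, or necessitation for the predicate
`Q(·, ⌜Q⌝)`, where `u = ⌜Q⌝`, leads from `x` to `z`. -/
def Step (u x y z : ℕ) : Prop := x = Nat.pair 2 (Nat.pair y z) ∨ z = diagonalCode u x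

theorem sigmaOne_step : SigmaOne fun v : Fin 4 → ℕ => Step (v 0) (v 1) (v 2) (v 3) := by
  have hd : Computable fun m : ℕ => diagonalCode m.unpair.1 m.unpair.2 :=
    (primrec_diagonalCode.comp (Primrec.fst.comp .unpair) (Primrec.snd.comp .unpair)).to_comp
  refine .of_iff (R := fun v : Fin 4 → ℕ => (∃ p t, p = Nat.pair (v 2) (v 3) ∧ t = 2 ∧
      v 1 = Nat.pair t p) ∨ ∃ m, m = Nat.pair (v 0) (v 1) ∧
        v 3 = diagonalCode m.unpair.1 m.unpair.2) (.or (.ex (.ex (.and ?_ (.and ?_ ?_))))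
          (.ex (.and ?_ ?_))) fun v => ?_
  · exact .eq_pair (.var _) (.var _) (.var _)
  · exact .eq (.var _) (.const 2)
  · exact .eq_pair (.var _) (.var _) (.var _)
  · exact .eq_pair (.var _) (.var _) (.var _)
  · exact .eq_computable hd _ _
  · simp [Step]

/-! ### The self-referential predicate and its meaning in a model. -/

variable (θ : LA.Formula (Fin 1)) (ρ : LA.Formula (Fin 4))

/-- The formula with free variable `u` (and a dummy variable) saying that the set defined by `θ`
is closed under the steps defined by `ρ(u, x, y, z)`. -/
noncomputable def closedFormula : LA.Formula (Fin 2) :=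
  Formula.iAlls (Fin 3) ((ρ.relabel ![.inl 1, .inr 0, .inr 1, .inr 2]).imp
    ((θ.relabel fun _ => .inr 0).imp ((θ.relabel fun _ => .inr 1).imp
      (θ.relabel fun _ => .inr 2))))

/-- The formula with free variables `x`, `u` saying that `x` satisfies `θ` if the set defined by
`θ` is closed under the steps defined by `ρ(u, x, y, z)`. -/
noncomputable def guardedFormula : LA.BoundedFormula Empty 2 :=
  BoundedFormula.relabel Sum.inr ((closedFormula θ ρ).imp (θ.relabel fun _ => 0))

/-- The predicate saying that `x` satisfies `θ`, if the set defined by `θ` is closed under modus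
ponens and under necessitation for this same predicate. The self-reference is obtained by
diagonalization. -/
noncomputable def guardedPredicate : Predicate :=
  instancePredicate (guardedFormula θ ρ) (formulaCode (guardedFormula θ ρ))

/-- The set defined by `θ` in `M` is closed under the steps defined by `ρ(u, x, y, z)`. -/
def ClosedIn (M : Type) [LA.Structure M] (u : M) : Prop :=
  ∀ x y z : M, ρ.Realize ![u, x, y, z] → θ.Realize ![x] → θ.Realize ![y] → θ.Realize ![z]

theorem realize_closedFormula {M : Type} [LA.Structure M] (x u : M) :
    (closedFormula θ ρ).Realize ![x, u] ↔ ClosedIn θ ρ M u := by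
  have h (w : Fin 3 → M) : (fun i => Sum.elim ![x, u] w ((![.inl 1, .inr 0, .inr 1, .inr 2] :
      Fin 4 → Fin 2 ⊕ Fin 3) i)) = ![u, w 0, w 1, w 2] := by
    ext i
    fin_cases i <;> rfl
  have h' (a : M) : (fun _ : Fin 1 => a) = ![a] := by
    ext i
    fin_cases i
    rfl
  simp only [closedFormula, Formula.realize_iAlls, Formula.realize_imp,
    Formula.realize_relabel, Function.comp_def, h, Sum.elim_inr, h', ClosedIn]
  exact ⟨fun H a b c => H ![a, b, c], fun H w => H _ _ _⟩

theorem realize_guardedPredicate {M : Type} [LA.Structure M] (A : LA.Sentence) :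
    M ⊨ (guardedPredicate θ ρ).ofSentence A ↔
      (ClosedIn θ ρ M (mNum M (formulaCode (guardedFormula θ ρ))) →
        θ.Realize ![mNum M (code A)]) := by
  have h (a b : M) : (fun _ : Fin 1 => (![a, b] : Fin 2 → M) 0) = ![a] := by
    ext i
    fin_cases i
    rfl
  rw [guardedPredicate, ofSentence_instancePredicate, realize_instanceSentence]
  -- The code becomes opaque first, so that the next unfolding affects the formula and not its own
  -- quotation.
  generalize formulaCode (guardedFormula θ ρ) = q
  rw [guardedFormula]
  refine (Formula.realize_relabel_sumInr _).trans ?_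
  rw [Formula.realize_imp, realize_closedFormula, Formula.realize_relabel]
  simp only [Function.comp_def, h]

/-- This closes the diagonalization: at u = ⌜Q⌝, the second kind of step is necessitation for the
very predicate that is guarded by closure under it. -/
theorem code_guardedPredicate (A : LA.Sentence) :
    code ((guardedPredicate θ ρ).ofSentence A) =
      diagonalCode (formulaCode (guardedFormula θ ρ)) (code A) := by
  rw [guardedPredicate, ofSentence_instancePredicate, code_instanceSentence]

variable {θ ρ} {T : Set LA.Sentence}

/-- A verifier sees sentences only through their codes; this stands in for injectivity of `code`. -/
theorem IsProofVerifier.mem_iff_of_code_eq {pc : ℕ → ℕ → Bool} (h : IsProofVerifier pc T)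
    {A B : LA.Sentence} (hAB : code A = code B) (hA : A ∈ T) : B ∈ T := by
  by_contra hB
  obtain ⟨p, hp⟩ := (h A).1 hA
  rw [hAB, (h B).2 hB p] at hp
  cases hp

theorem IsTheory.mem_of_forall_model (hT : IsTheory T) {A : LA.Sentence}
    (h : ∀ (M : Type) [LA.Structure M], (∀ B ∈ T, M ⊨ B) → M ⊨ A) : A ∈ T :=
  hT A <| Theory.models_sentence_iff.2 fun M =>
    h M fun _ hB => Theory.realize_sentence_of_mem (M := M) T hB

theorem isQModel_of_PA_subset (hPA : PA ⊆ T) {M : Type} [LA.Structure M]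
    (hM : ∀ B ∈ T, M ⊨ B) : IsQModel M :=
  isQModel_of_qAxiom fun A hA => hM A <| hPA <| Theory.models_sentence_iff.2 fun N =>
    Theory.realize_sentence_of_mem (M := N) {B | PAAxiom B} (PAAxiom.q hA)

theorem IsTheory.imp_mem (hT : IsTheory T) {A B : LA.Sentence} (hAB : A.imp B ∈ T)
    (hA : A ∈ T) : B ∈ T :=
  hT.mem_of_forall_model fun _ _ hM => (Formula.realize_imp.1 (hM _ hAB)) (hM _ hA)

end Provability

/-! ### Derivability conditions in all models, correctness in ℕ. -/

section Existence

variable {θ : LA.Formula (Fin 1)} {ρ : LA.Formula (Fin 4)} {T : Set LA.Sentence}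

theorem Represents.realize_num_one {R : (Fin 1 → ℕ) → Prop} (h : Represents θ R) {M : Type}
    [LA.Structure M] (hM : IsQModel M) {a : ℕ} (ha : R ![a]) : θ.Realize ![mNum M a] := by
  convert h.2 M hM _ ha using 1
  ext i
  fin_cases i
  rfl

theorem Represents.realize_step (h : Represents ρ fun v => Step (v 0) (v 1) (v 2) (v 3))
    {M : Type} [LA.Structure M] (hM : IsQModel M) {u x y z : ℕ} (hs : Step u x y z) :
    ρ.Realize ![mNum M u, mNum M x, mNum M y, mNum M z] := by
  convert h.2 M hM ![u, x, y, z] hs using 1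
  ext i
  fin_cases i <;> rfl

/-- The derivability conditions for the guarded predicate. -/
theorem derivabilityConditions_guardedPredicate (hT : IsTheory T) (hPA : PA ⊆ T)
    (hθ : Represents θ fun v => ∃ A ∈ T, code A = v 0)
    (hρ : Represents ρ fun v => Step (v 0) (v 1) (v 2) (v 3)) :
    DerivabilityConditions (guardedPredicate θ ρ) T where
  representability A hA := hT.mem_of_forall_model fun M _ hM =>
    (realize_guardedPredicate θ ρ A).2 fun _ =>
      hθ.realize_num_one (isQModel_of_PA_subset hPA hM) ⟨A, hA, rfl⟩
  distributivity A B := hT.mem_of_forall_model fun M _ hM => by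
    refine Formula.realize_imp.2 fun hAB => Formula.realize_imp.2 fun hA => ?_
    refine (realize_guardedPredicate θ ρ B).2 fun hC => ?_
    -- Both premises carry the same guard, so `hC` releases θ for each of them; the code of an
    -- implication is by definition the one required by modus ponens.
    exact hC _ _ _ (hρ.realize_step (isQModel_of_PA_subset hPA hM) (.inl rfl))
      ((realize_guardedPredicate θ ρ _).1 hAB hC) ((realize_guardedPredicate θ ρ _).1 hA hC)
  reRepresentability A := hT.mem_of_forall_model fun M _ hM => by
    refine Formula.realize_imp.2 fun hA => (realize_guardedPredicate θ ρ _).2 fun hC => ?_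
    have hA := (realize_guardedPredicate θ ρ A).1 hA hC
    rw [code_guardedPredicate]
    -- Necessitation ignores the second premise y, so A is supplied twice.
    exact hC _ _ _ (hρ.realize_step (isQModel_of_PA_subset hPA hM) (.inr rfl)) hA hA

/-- In the standard model the set of codes of theorems is closed under modus ponens and under
necessitation for the guarded predicate. -/
theorem closedIn_nat (hT : IsTheory T) (hPA : PA ⊆ T) (hce : IsCE T)
    (hθ : Represents θ fun v => ∃ A ∈ T, code A = v 0)
    (hρ : Represents ρ fun v => Step (v 0) (v 1) (v 2) (v 3)) :
    ClosedIn θ ρ ℕ (mNum ℕ (formulaCode (guardedFormula θ ρ))) := by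
  obtain ⟨pc, -, hpc⟩ := hce
  intro x y z hs hx hy
  rw [hθ.1] at hx hy ⊢
  obtain ⟨A, hA, rfl⟩ : ∃ A ∈ T, code A = x := hx
  obtain ⟨B, hB, rfl⟩ : ∃ B ∈ T, code B = y := hy
  rcases (hρ.1 _).1 hs with h | h
  · have h : code A = Nat.pair 2 (Nat.pair (code B) z) := h
    obtain ⟨C, D, rfl, hC, rfl⟩ : ∃ C D : LA.Sentence, A = C.imp D ∧ code C = code B ∧
        code D = z := by
      cases A with
      | falsum | equal | all => simp [code, formulaCode, Nat.pair_eq_pair] at h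
      | rel r => exact Empty.elim r
      | imp C D =>
        simp only [code, formulaCode, Nat.pair_eq_pair, true_and] at h
        exact ⟨C, D, rfl, h.1, h.2⟩
    -- The antecedent C is known to match B only in code, so its membership is transferred through
    -- the verifier.
    exact ⟨D, hT.imp_mem hA (hpc.mem_iff_of_code_eq hC.symm hB), rfl⟩
  · have h : z = diagonalCode (mNum ℕ (formulaCode (guardedFormula θ ρ))) (code A) := h
    -- There is no circularity: representability was obtained without assuming closure.
    refine ⟨_, (derivabilityConditions_guardedPredicate hT hPA hθ hρ).representability A hA, ?_⟩
    rw [code_guardedPredicate, ← mNum_nat (formulaCode _)]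
    exact h.symm

theorem isProvabilityPredicate_guardedPredicate (hT : IsTheory T) (hPA : PA ⊆ T) (hce : IsCE T)
    (hθ : Represents θ fun v => ∃ A ∈ T, code A = v 0)
    (hρ : Represents ρ fun v => Step (v 0) (v 1) (v 2) (v 3)) :
    IsProvabilityPredicate (guardedPredicate θ ρ) T := by
  intro A
  refine (realize_guardedPredicate θ ρ A).trans ?_
  -- The guard is true in ℕ and drops out.
  rw [forall_prop_of_true (closedIn_nat hT hPA hce hθ hρ), hθ.1, mNum_nat]
  constructor
  · rintro ⟨B, hB, h⟩
    obtain ⟨pc, -, hpc⟩ := hce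
    exact hpc.mem_iff_of_code_eq h hB
  · exact fun hA => ⟨A, hA, rfl⟩

end Existence

end Arith

/-- Every computably enumerable extension of Peano arithmetic has a strong provability predicate. -/
theorem mainTheorem4 (T : Set Arith.LA.Sentence) (hT : Arith.IsTheory T) (hPA : Arith.PA ⊆ T)
    (hce : Arith.IsCE T) :
    ∃ P : Arith.Predicate, Arith.IsStrongProvabilityPredicate P T := by
  obtain ⟨θ, hθ⟩ := Arith.sigmaOne_theorems hce
  obtain ⟨ρ, hρ⟩ := Arith.sigmaOne_step
  exact ⟨Arith.guardedPredicate θ ρ,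
    Arith.isProvabilityPredicate_guardedPredicate hT hPA hce hθ hρ,
    Arith.derivabilityConditions_guardedPredicate hT hPA hθ hρ⟩
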